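/- **Setting.** A *stationary Markov-modulated process (MMP)* is given by a finite state space $\mathcal X$, the transition matrix $P$ of an ergodic (irreducible and aperiodic) Markov chain on $\mathcal X$ with stationary distribution $\pi$, and, for each $x\in\mathcal X$, a probability distribution on $\mathbb N$ with moment-generating function $\varphi_x$. Let $(X(t))_{t\in\mathbb Z}$ be a stationary Markov chain with transition matrix $P$ and one-dimensional marginals $\pi$, and for each $x\in\mathcal X$ let $(Y_x(t))_{t\in\mathbb Z}$ be i.i.d. with the distribution attached to $x$, the chain and the sequences $(Y_x(t))_t$, $x\in\mathcal X$, being mutually independent. The MMP is the sequence $y_t=Y_{X(t)}(t)$, and the bivariate process it generates is $(t,u)\mapsto\sum_{k=t}^{u-1}y_k$ for $t\le u$. Put $P^r_{i,j}=\frac{\pi_j}{\pi_i}P_{j,i}$ and $\psi(\theta)=(P^r_{i,j}\,\varphi_j(\theta))_{i,j\in\mathcal X}$. When all $\varphi_x(\theta)$ are finite, let $\lambda(\theta)>0$ be the Perron–Frobenius eigenvalue (the eigenvalue of largest modulus) of $\psi(\theta)$. For an arrival process $A$ generated by an MMP let $\rho_A(\theta)=\frac1\theta\ln\lambda_A(\theta)$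 (and $\rho_A(\theta)=+\infty$ if some $\varphi_{A,x}(\theta)$ is infinite); for a service process $S$ generated by an MMP let $\rho_S(\theta)=-\frac1\theta\ln\lambda_S(-\theta)$. At $\theta=0$ set $\rho_A(0)=\rho_S(0)=0$. **Theorem.** Let $m\ge 0$, let the parameters (state space, transition matrix, distributions) of $m$ arrival MMPs and of one service MMP be given, and let $\theta\ge 0$ be such that $\rho_{A_i}(\theta)<\infty$ for all $i$ and $$\sum_{i=1}^m\rho_{A_i}(\theta)-\rho_S(\theta)\le 0 .$$ Then there is a constant $\xi=\xi_{(A_i),S}(\theta)\in(0,\infty)$, depending only on these parameters and on $\theta$, such that the following holds. Let $A_1,\dots,A_m,S$ be mutually independent processes on a probability space, generated by stationary MMPs with the given parameters, let $Y$ be a real random variable independent of $(A_1,\dots,A_m,S)$, let $(u_i,v_i)_{i=0}^m$ be pairs of natural numbers with $u_i\le v_i$, and put, for $\tau\in\mathbb N$, $$W_\tau=\sum_{i=1}^m A_i(u_i-\tau,v_i)-S(u_0-\tau,v_0).$$ Then $$\mathbf P\Big(\sup_{\tau\ge 0}W_\tau\ge Y\Big)\le \xi\;\mathbf E\big[e^{-\theta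 Y}\big]\;e^{\theta\left(\sum_{i=1}^m\rho_{A_i}(\theta)(v_i-u_i)-\rho_S(\theta)(v_0-u_0)\right)} ,$$ where the right-hand side may be $+\infty$. -/

import Mathlib

universe u v w

open MeasureTheory ProbabilityTheory

noncomputable section

namespace MMP

/-- The parameters of a stationary Markov-modulated process: a finite state space with an ergodic
(primitive) transition matrix `P`, its stationary distribution, and for every state `x` the
distribution `law x` of the amount of data (a natural number) generated in a time slot spent
in state `x`. -/
structure Model : Type (u + 1) where
  State : Type u
  [fintype : Fintype State]
  [decEq : DecidableEq State]
  /-- the transition matrix -/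
  P : Matrix State State ℝ
  stochastic : P ∈ Matrix.rowStochastic ℝ State
  ergodic : P.IsPrimitive
  /-- the stationary distribution -/
  stat : State → ℝ
  stat_mem : stat ∈ stdSimplex ℝ State
  stat_invariant : Matrix.vecMul stat P = stat
  law : State → PMF ℕ

namespace Model

instance (M : Model.{u}) : Fintype M.State := M.fintype

instance (M : Model.{u}) : DecidableEq M.State := M.decEq

instance (M : Model.{u}) : MeasurableSpace M.State := ⊤

variable (M : Model.{u})

/-- The moment-generating function `φ_x` of the data generated in state `x`. -/
def stateMGF (x : M.State) (θ : ℝ) : ℝ :=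
  mgf (fun n : ℕ => (n : ℝ)) (M.law x).toMeasure θ

/-- `φ_x(θ)` is finite for every state `x`, i.e. the exponential transition matrix is finite
at `θ`. -/
def MGFFinite (θ : ℝ) : Prop :=
  ∀ x : M.State, θ ∈ integrableExpSet (fun n : ℕ => (n : ℝ)) (M.law x).toMeasure

/-- The transition matrix of the time-reversed chain, `π_j / π_i * P_{j,i}`. -/
def reversed : Matrix M.State M.State ℝ :=
  Matrix.of fun i j => M.stat j / M.stat i * M.P j i

/-- The exponential transition matrix `ψ(θ)`, with entries `Pʳ_{i,j} φ_j(θ)`. -/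
def expTransition (θ : ℝ) : Matrix M.State M.State ℝ :=
  Matrix.of fun i j => M.reversed i j * M.stateMGF j θ

/-- The Perron-Frobenius eigenvalue `λ(θ)` of `ψ(θ)`, that is, the largest modulus of a complex
eigenvalue. -/
def perronRoot (θ : ℝ) : ℝ :=
  (spectralRadius ℂ ((M.expTransition θ).map (fun r : ℝ => (r : ℂ)))).toReal

/-- `ρ_A(θ) = (1 / θ) log λ_A(θ)` for an arrival process (and `0` at `θ = 0`). -/
def arrivalRate (θ : ℝ) : ℝ := 1 / θ * Real.log (M.perronRoot θ)

/-- `ρ_S(θ) = - (log λ_S(-θ)) / θ` for a service process (and `0` at `θ = 0`). -/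
def serviceRate (θ : ℝ) : ℝ := -(Real.log (M.perronRoot (-θ)) / θ)

end Model

/-- `X` is a stationary Markov chain indexed by `ℤ` with the transition matrix and the stationary
distribution of `M`; for each state `x`, `(D x t)_t` is an i.i.d. sequence with distribution
`M.law x`; and the chain and the sequences `D x` are mutually independent. -/
structure IsModulation (M : Model.{u}) {Ω : Type w} [MeasurableSpace Ω] (μ : Measure Ω)
    (X : ℤ → Ω → M.State) (D : M.State → ℤ → Ω → ℕ) : Prop where
  measurable_chain : ∀ t, Measurable (X t)
  measurable_data : ∀ x t, Measurable (D x t)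
  stationary : ∀ t x, μ {ω | X t ω = x} = ENNReal.ofReal (M.stat x)
  markov : ∀ (t : ℤ) (n : ℕ) (x : ℕ → M.State),
    μ {ω | ∀ k ≤ n + 1, X (t + k) ω = x k} =
      μ {ω | ∀ k ≤ n, X (t + k) ω = x k} * ENNReal.ofReal (M.P (x n) (x (n + 1)))
  data_law : ∀ x t, μ.map (D x t) = (M.law x).toMeasure
  indep_data : iIndepFun (fun p : M.State × ℤ => D p.1 p.2) μ
  indep_chain : IndepFun (fun ω (t : ℤ) => X t ω) (fun ω (x : M.State) (t : ℤ) => D x t ω) μ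

/-- `y` (the sequence of the amounts of data per time slot) is a stationary Markov-modulated
process with parameters `M`: `y_t = Y_{X(t)}(t)`. -/
def IsStationaryMMP (M : Model.{u}) {Ω : Type w} [MeasurableSpace Ω] (μ : Measure Ω)
    (y : ℤ → Ω → ℕ) : Prop :=
  ∃ (X : ℤ → Ω → M.State) (D : M.State → ℤ → Ω → ℕ),
    IsModulation M μ X D ∧ ∀ t ω, y t ω = D (X t ω) t ω

/-- The bivariate process `(t, u) ↦ ∑_{k = t}^{u - 1} y_k` with increments `y`. -/
def cumul {Ω : Type w} (y : ℤ → Ω → ℕ) (t u : ℤ) (ω : Ω) : ℕ :=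
  ∑ k ∈ Finset.Ico t u, y k ω

/-- `W_τ = ∑_{i=1}^m A_i(u_i - τ, v_i) - S(u_0 - τ, v_0)`, where `A_i` and `S` have the increments
`a i` and `s`. The index `i : Fin m` of a flow corresponds to the entry `i.succ` of `u` and `v`,
and the entry `0` is that of the server. -/
def netInput {Ω : Type w} {m : ℕ} (a : Fin m → ℤ → Ω → ℕ) (s : ℤ → Ω → ℕ)
    (u v : Fin (m + 1) → ℕ) (τ : ℕ) (ω : Ω) : ℤ :=
  ∑ i : Fin m, (cumul (a i) ((u i.succ : ℤ) - τ) (v i.succ) ω : ℤ)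
    - (cumul s ((u 0 : ℤ) - τ) (v 0) ω : ℤ)

end MMP

end

/-! The proof is a change of measure along the reversed time direction. For one MMP and an exponent
`c`, let `x > 0` be a Perron eigenvector of `ψ(c)` and `λ` its eigenvalue. The reversed chain has
transition matrix `Pʳ`, so by the eigenvector equation `x(X(v-n)) · exp(c · A(v-n, v)) / λ^n` is a
martingale in `n`. Since `x` lies between positive constants, this martingale, normalised to mean
one, dominates `exp(c · A(v-n, v) - n log λ)` up to a constant factor
(`Model.exists_hasExpMartingale`).

Arrivals are given the exponent `θ` and the service `-θ`. On a product space the individual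
martingales are densities of product measures `Q τ`, even though the windows of the flows have
different lengths. The stability condition says that the logarithms of the Perron roots have
nonpositive sum. Extending all windows by `τ` therefore does no harm: on the event that the level is
reached at `τ`, the density of `Q τ` is bounded below uniformly in `τ`. Consistency of the `Q τ` on
first-entrance events then bounds the probability of ever reaching the level
(`measure_iUnion_le_of_domination`, `pi_measure_exists_le`), and integration over the independent
level gives the factor `E[e^{-θY}]`. -/

namespace Matrix

/-! ### Perron–Frobenius theory of primitive matrices -/

/-- A nonnegative vector `x ≠ 0` is sent to a positive vector by a positive matrix. -/
lemma mulVec_pos_of_forall_pos {n : Type*} [Fintype n] {B : Matrix n n ℝ}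
    (hB : ∀ i j, 0 < B i j) {x : n → ℝ} (hx : ∀ i, 0 ≤ x i) (hx0 : x ≠ 0) (i : n) : 0 < (B *ᵥ x) i := by
  obtain ⟨j, hj⟩ := Function.ne_iff.1 hx0
  exact Finset.sum_pos' (fun k _ => mul_nonneg (hB i k).le (hx k))
    ⟨j, Finset.mem_univ j, mul_pos (hB i j) (lt_of_le_of_ne (hx j) (Ne.symm hj))⟩

variable {n : Type*} [Fintype n] [DecidableEq n]

/-- **Perron's theorem**, existence of a positive eigenvector of a primitive matrix. -/
theorem IsPrimitive.exists_pos_eigenvector [Nonempty n] {A : Matrix n n ℝ}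
    (hA : A.IsPrimitive) : ∃ (r : ℝ) (x : n → ℝ), 0 < r ∧ (∀ i, 0 < x i) ∧ A *ᵥ x = r • x := by
  obtain ⟨hA0, k, hk, hpos⟩ := hA
  set C : ℝ := ∑ i, ∑ j, A i j with hC
  -- Collatz–Wielandt: `r` will be the largest `s` with `s y ≤ A y` for some `y` in the simplex.
  -- Every such `s` is at most the sum `C` of the entries, which makes the set of pairs compact.
  set K : Set (ℝ × (n → ℝ)) :=
    {p | p.1 ∈ Set.Icc 0 C ∧ p.2 ∈ stdSimplex ℝ n ∧ ∀ i, p.1 * p.2 i ≤ (A *ᵥ p.2) i} with hK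
  have hKc : IsCompact K := by
    have : K = (Set.Icc 0 C ×ˢ stdSimplex ℝ n) ∩ {p | ∀ i, p.1 * p.2 i ≤ (A *ᵥ p.2) i} := by
      ext p
      simp [hK, and_assoc]
    rw [this]
    refine (isCompact_Icc.prod (isCompact_stdSimplex ℝ n)).inter_right ?_
    simp only [Set.ofPred_forall]
    refine isClosed_iInter fun i => isClosed_le (by fun_prop) ?_
    simp only [mulVec, dotProduct]
    fun_prop
  have hC0 : 0 ≤ C := Finset.sum_nonneg fun i _ => Finset.sum_nonneg fun j _ => hA0 i j
  have hKn : K.Nonempty := by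
    obtain ⟨i⟩ := ‹Nonempty n›
    refine ⟨(0, Pi.single i 1), ⟨le_rfl, hC0⟩, single_mem_stdSimplex ℝ i, fun j => ?_⟩
    simpa using hA0 j i
  obtain ⟨⟨r, x⟩, ⟨hr, hx, hle⟩, hmax⟩ := hKc.exists_isMaxOn hKn continuousOn_fst
  have hmem : ∀ (s : ℝ) (y : n → ℝ), 0 ≤ s → (∀ i, 0 ≤ y i) → y ≠ 0 →
      (∀ i, s * y i ≤ (A *ᵥ y) i) → s ≤ r := by
    intro s y hs hy hy0 hsy
    obtain ⟨j, hj⟩ := Function.ne_iff.1 hy0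
    have hS : 0 < ∑ i, y i :=
      Finset.sum_pos' (fun i _ => hy i) ⟨j, Finset.mem_univ j, lt_of_le_of_ne (hy j) (Ne.symm hj)⟩
    have hsC : s ≤ C := by
      have h1 : s * ∑ i, y i ≤ C * ∑ i, y i := by
        calc s * ∑ i, y i = ∑ i, s * y i := Finset.mul_sum ..
          _ ≤ ∑ i, (A *ᵥ y) i := Finset.sum_le_sum fun i _ => hsy i
          _ ≤ ∑ i, ∑ j, A i j * ∑ l, y l := by
              refine Finset.sum_le_sum fun i _ => Finset.sum_le_sum fun j _ => ?_
              exact mul_le_mul_of_nonneg_left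
                (Finset.single_le_sum (fun l _ => hy l) (Finset.mem_univ j)) (hA0 i j)
          _ = C * ∑ i, y i := by simp only [hC, Finset.sum_mul]
      exact le_of_mul_le_mul_right h1 hS
    have : (s, (∑ i, y i)⁻¹ • y) ∈ K := by
      refine ⟨⟨hs, hsC⟩, ⟨fun i => ?_, ?_⟩, fun i => ?_⟩
      · exact mul_nonneg (inv_nonneg.2 hS.le) (hy i)
      · simp only [Pi.smul_apply, smul_eq_mul, ← Finset.mul_sum]
        exact inv_mul_cancel₀ hS.ne'
      · simp only [mulVec_smul, Pi.smul_apply, smul_eq_mul]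
        rw [mul_left_comm]
        exact mul_le_mul_of_nonneg_left (hsy i) (inv_nonneg.2 hS.le)
    exact hmax this
  have hx0 : x ≠ 0 := by
    rintro rfl
    simpa using hx.2
  have hB := mulVec_pos_of_forall_pos hpos hx.1 hx0
  have heq : A *ᵥ x = r • x := by
    -- Otherwise the positive matrix `A ^ k` turns the nonzero nonnegative vector `A x - r x` into a
    -- positive one. Then `y = A ^ k x` satisfies `A y > r y` strictly, and `r` could be increased.
    by_contra hne
    have hz := mulVec_pos_of_forall_pos hpos (x := A *ᵥ x - r • x)
      (fun i => sub_nonneg.2 (by simpa using hle i)) (sub_ne_zero.2 hne)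
    set y := (A ^ k) *ᵥ x with hy
    have hAy : ∀ i, 0 < (A *ᵥ y) i - r * y i := by
      intro i
      have := hz i
      rwa [mulVec_sub, mulVec_smul, mulVec_mulVec, ← pow_succ, pow_succ', ← mulVec_mulVec] at this
    obtain ⟨i₀, hi₀⟩ := Finite.exists_min fun i => ((A *ᵥ y) i - r * y i) / y i
    set ε := ((A *ᵥ y) i₀ - r * y i₀) / y i₀
    have hε : 0 < ε := div_pos (hAy i₀) (hB i₀)
    have := hmem (r + ε) y (add_nonneg hr.1 hε.le) (fun i => (hB i).le)
      (fun h => (hB i₀).ne' (by rw [h]; rfl)) (fun i => by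
        have := (le_div_iff₀ (hB i)).1 (hi₀ i)
        linarith)
    linarith
  have hpow : ∀ l : ℕ, (A ^ l) *ᵥ x = r ^ l • x := by
    intro l
    induction l with
    | zero => simp
    | succ l ih => rw [pow_succ, ← mulVec_mulVec, heq, mulVec_smul, ih, smul_smul, pow_succ']
  have hprod : ∀ i, 0 < r ^ k * x i := fun i => by simpa [hpow] using hB i
  obtain ⟨i₁⟩ := ‹Nonempty n›
  refine ⟨r, x, lt_of_le_of_ne hr.1 ?_, fun i => ?_, heq⟩
  · rintro rfl
    simpa [hk.ne'] using hprod i₁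
  · exact pos_of_mul_pos_right (hprod i) (pow_nonneg hr.1 k)

/-- The eigenvalue of a positive eigenvector of a nonnegative matrix is the spectral radius. -/
theorem spectralRadius_eq_of_pos_eigenvector [Nonempty n] {A : Matrix n n ℝ}
    (hA : ∀ i j, 0 ≤ A i j) {r : ℝ} {x : n → ℝ} (hr : 0 ≤ r) (hx : ∀ i, 0 < x i)
    (h : A *ᵥ x = r • x) :
    spectralRadius ℂ (A.map (fun t : ℝ => (t : ℂ))) = ENNReal.ofReal r := by
  have hmem : ∀ k : ℂ, k ∈ spectrum ℂ (A.map (fun t : ℝ => (t : ℂ))) ↔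
      ∃ w : n → ℂ, w ≠ 0 ∧ A.map (fun t : ℝ => (t : ℂ)) *ᵥ w = k • w := by
    intro k
    rw [← Matrix.spectrum_toLin', ← Module.End.hasEigenvalue_iff_mem_spectrum]
    constructor
    · intro hk
      obtain ⟨w, hw⟩ := hk.exists_hasEigenvector
      exact ⟨w, hw.2, by simpa using hw.apply_eq_smul⟩
    · rintro ⟨w, hw0, hw⟩
      exact Module.End.hasEigenvalue_of_hasEigenvector (x := w)
        (Module.End.hasEigenvector_iff.2 ⟨Module.End.mem_eigenspace_iff.2 (by simpa using hw), hw0⟩)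
  apply le_antisymm
  · refine iSup₂_le fun k hk => ?_
    obtain ⟨w, hw0, hw⟩ := (hmem k).1 hk
    -- At an index maximising `‖w i‖ / x i`, the eigenvalue equation of `w` can be compared with
    -- that of `x`.
    obtain ⟨i, hi⟩ := Finite.exists_max fun i => ‖w i‖ / x i
    set s := ‖w i‖ / x i
    have hws : ∀ j, ‖w j‖ ≤ s * x j := fun j => (div_le_iff₀ (hx j)).1 (hi j)
    have hwi : ‖w i‖ = s * x i := (div_mul_cancel₀ _ (hx i).ne').symm
    have hs : 0 < s := by
      obtain ⟨j, hj⟩ := Function.ne_iff.1 hw0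
      exact lt_of_lt_of_le (div_pos (norm_pos_iff.2 hj) (hx j)) (hi j)
    have h1 : ‖k‖ * ‖w i‖ ≤ r * ‖w i‖ := by
      calc ‖k‖ * ‖w i‖ = ‖∑ j, (A i j : ℂ) * w j‖ := by
            rw [← norm_mul, ← smul_eq_mul, ← Pi.smul_apply, ← hw]
            rfl
        _ ≤ ∑ j, A i j * (s * x j) := by
            refine norm_sum_le_of_le _ fun j _ => ?_
            rw [norm_mul, Complex.norm_real, Real.norm_of_nonneg (hA i j)]
            exact mul_le_mul_of_nonneg_left (hws j) (hA i j)
        _ = s * (A *ᵥ x) i := by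
            simp only [mulVec, dotProduct, Finset.mul_sum]
            exact Finset.sum_congr rfl fun j _ => by ring
        _ = r * ‖w i‖ := by
            rw [h, hwi, Pi.smul_apply, smul_eq_mul]
            ring
    have h2 : ‖k‖ ≤ r := le_of_mul_le_mul_right h1 (hwi ▸ mul_pos hs (hx i))
    rw [← enorm_eq_nnnorm, ← ofReal_norm]
    exact ENNReal.ofReal_le_ofReal h2
  · have hk : (r : ℂ) ∈ spectrum ℂ (A.map (fun t : ℝ => (t : ℂ))) := by
      refine (hmem _).2 ⟨fun i => (x i : ℂ), ?_, ?_⟩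
      · obtain ⟨i⟩ := ‹Nonempty n›
        exact Function.ne_iff.2 ⟨i, by simpa using (hx i).ne'⟩
      · ext i
        have := congrFun h i
        simp only [mulVec, dotProduct, Pi.smul_apply, smul_eq_mul, map_apply] at this ⊢
        exact_mod_cast this
    refine le_trans (le_of_eq ?_) (le_iSup₂ (f := fun k _ => (‖k‖₊ : ENNReal)) (r : ℂ) hk)
    rw [← enorm_eq_nnnorm, ← ofReal_norm, Complex.norm_real, Real.norm_of_nonneg hr]

end Matrix

/-! ### The exponential transition matrix and its Perron root -/

namespace MMP.Model

variable (M : Model.{u})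

instance : Nonempty M.State := by
  by_contra h
  rw [not_nonempty_iff] at h
  simpa using M.stat_mem.2

instance : DiscreteMeasurableSpace M.State := ⟨fun _ => trivial⟩

lemma stat_pos (x : M.State) : 0 < M.stat x := by
  obtain ⟨k, -, hpos⟩ := M.ergodic.exists_pos_pow
  have hinv : ∀ l : ℕ, Matrix.vecMul M.stat (M.P ^ l) = M.stat := by
    intro l
    induction l with
    | zero => simp
    | succ l ih => rw [pow_succ', ← Matrix.vecMul_vecMul, M.stat_invariant, ih]
  have h0 : M.stat ≠ 0 := fun h => by simpa [h] using M.stat_mem.2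
  rw [← hinv k, ← Matrix.mulVec_transpose]
  exact Matrix.mulVec_pos_of_forall_pos (fun i j => hpos j i) M.stat_mem.1 h0 x

lemma stateMGF_pos {θ : ℝ} (h : M.MGFFinite θ) (x : M.State) : 0 < M.stateMGF x θ :=
  mgf_pos (h x)

lemma MGFFinite_of_nonpos {θ : ℝ} (h : θ ≤ 0) : M.MGFFinite θ := by
  intro x
  refine Integrable.of_bound (C := 1) (by fun_prop) (Filter.Eventually.of_forall fun n => ?_)
  rw [Real.norm_of_nonneg (Real.exp_nonneg _)]
  exact Real.exp_le_one_iff.2 (mul_nonpos_of_nonpos_of_nonneg h n.cast_nonneg)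

lemma lintegral_exp_law {θ : ℝ} (h : M.MGFFinite θ) (x : M.State) :
    ∫⁻ n : ℕ, ENNReal.ofReal (Real.exp (θ * n)) ∂(M.law x).toMeasure =
      ENNReal.ofReal (M.stateMGF x θ) :=
  (ofReal_integral_eq_lintegral_ofReal (h x)
    (Filter.Eventually.of_forall fun _ => Real.exp_nonneg _)).symm

/-- Entrywise `ψ(θ) ≥ ε Pᵀ` for some `ε > 0`, hence `ψ(θ) ^ k ≥ ε ^ k (P ^ k)ᵀ`, and positivity of a
power passes from `P` to `ψ(θ)`. -/
lemma expTransition_isPrimitive {θ : ℝ} (h : M.MGFFinite θ) :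
    (M.expTransition θ).IsPrimitive := by
  obtain ⟨hP, k, hk, hpos⟩ := M.ergodic
  have hc : ∀ i j, 0 < M.stat j / M.stat i * M.stateMGF j θ := fun i j =>
    mul_pos (div_pos (M.stat_pos j) (M.stat_pos i)) (M.stateMGF_pos h j)
  obtain ⟨p, hp⟩ := Finite.exists_min fun p : M.State × M.State =>
    M.stat p.2 / M.stat p.1 * M.stateMGF p.2 θ
  set ε := M.stat p.2 / M.stat p.1 * M.stateMGF p.2 θ
  have hε : 0 < ε := hc _ _
  have hle : ∀ i j, ε * M.P j i ≤ M.expTransition θ i j := fun i j =>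
    (mul_le_mul_of_nonneg_right (hp (i, j)) (hP j i)).trans_eq (by
      simp only [expTransition, reversed, Matrix.of_apply]
      ring)
  have hpw : ∀ (l : ℕ) (i j), 0 ≤ (M.P ^ l) i j ∧
      ε ^ l * (M.P ^ l) j i ≤ (M.expTransition θ ^ l) i j := by
    intro l
    induction l with
    | zero => intro i j; simp [Matrix.one_apply, eq_comm]; split_ifs <;> simp
    | succ l ih =>
      intro i j
      constructor
      · rw [pow_succ, Matrix.mul_apply]
        exact Finset.sum_nonneg fun z _ => mul_nonneg (ih i z).1 (hP z j)
      · rw [pow_succ (M.expTransition θ), pow_succ' M.P, Matrix.mul_apply, Matrix.mul_apply,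
          Finset.mul_sum]
        refine Finset.sum_le_sum fun z _ => ?_
        calc ε ^ (l + 1) * (M.P j z * (M.P ^ l) z i)
            = (ε ^ l * (M.P ^ l) z i) * (ε * M.P j z) := by ring
          _ ≤ _ := mul_le_mul (ih i z).2 (hle z j) (mul_nonneg hε.le (hP j z))
              ((mul_nonneg (pow_nonneg hε.le l) (ih z i).1).trans (ih i z).2)
  exact ⟨fun i j => (mul_nonneg hε.le (hP j i)).trans (hle i j), k, hk, fun i j =>
    (mul_pos (pow_pos hε k) (hpos j i)).trans_le (hpw k i j).2⟩

/-- The Perron root is positive and is the eigenvalue of a positive eigenvector. -/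
lemma exists_perron_eigenvector {θ : ℝ} (h : M.MGFFinite θ) :
    0 < M.perronRoot θ ∧ ∃ x : M.State → ℝ, (∀ i, 0 < x i) ∧
      ∀ i, ∑ j, M.expTransition θ i j * x j = M.perronRoot θ * x i := by
  obtain ⟨r, x, hr, hx, heq⟩ := (M.expTransition_isPrimitive h).exists_pos_eigenvector
  have hrad : M.perronRoot θ = r := by
    rw [perronRoot, Matrix.spectralRadius_eq_of_pos_eigenvector
      (M.expTransition_isPrimitive h).nonneg hr.le hx heq, ENNReal.toReal_ofReal hr.le]
  exact ⟨hrad ▸ hr, x, hx, fun i => hrad ▸ congrFun heq i⟩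

end MMP.Model

/-- Integration of a function of two independent random variables, the first of which takes
finitely many values. -/
lemma ProbabilityTheory.IndepFun.lintegral_eq_sum {Ω α β : Type*} [MeasurableSpace Ω]
    [Fintype α] [MeasurableSpace α] [MeasurableSingletonClass α] [MeasurableSpace β]
    {μ : Measure Ω} {ξ : Ω → α} {D : Ω → β} (hξ : Measurable ξ) (hD : Measurable D)
    (h : IndepFun ξ D μ) {F : α → β → ENNReal} (hF : ∀ x, Measurable (F x)) :
    ∫⁻ ω, F (ξ ω) (D ω) ∂μ = ∑ x, μ {ω | ξ ω = x} * ∫⁻ ω, F x (D ω) ∂μ := by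
  classical
  have h1 : ∀ ω, F (ξ ω) (D ω) = ∑ x, Set.indicator {x} (fun _ => 1) (ξ ω) * F x (D ω) := by
    intro ω
    rw [Finset.sum_eq_single (ξ ω)] <;> simp +contextual [Set.indicator, eq_comm]
  simp_rw [h1]
  rw [lintegral_finsetSum _ fun x _ => by
    exact ((measurable_one.indicator (measurableSet_singleton x)).comp hξ).mul ((hF x).comp hD)]
  refine Finset.sum_congr rfl fun x _ => ?_
  have hind : Measurable (Set.indicator ({x} : Set α) fun _ => (1 : ENNReal)) :=
    measurable_one.indicator (measurableSet_singleton x)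
  refine (lintegral_mul_eq_lintegral_mul_lintegral_of_indepFun''
    (hind.comp hξ).aemeasurable ((hF x).comp hD).aemeasurable (h.comp hind (hF x))).trans ?_
  congr 1
  simp only [Function.comp_apply]
  have : ∀ ω, Set.indicator ({x} : Set α) (fun _ => (1 : ENNReal)) (ξ ω) =
      Set.indicator {ω | ξ ω = x} 1 ω := fun ω => by simp [Set.indicator]
  simp_rw [this]
  exact lintegral_indicator_one (hξ (measurableSet_singleton x))

/-! ### Time reversal and one step of the perturbed chain -/

namespace MMP

variable {Ω : Type w} [MeasurableSpace Ω] {μ : Measure Ω}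

namespace IsModulation

variable {M : Model.{u}} {X : ℤ → Ω → M.State} {D : M.State → ℤ → Ω → ℕ}

lemma path_prob (h : IsModulation M μ X D) (t : ℤ) (n : ℕ) (x : ℕ → M.State) :
    μ {ω | ∀ k ≤ n, X (t + k) ω = x k} =
      ENNReal.ofReal (M.stat (x 0)) *
        ∏ k ∈ Finset.range n, ENNReal.ofReal (M.P (x k) (x (k + 1))) := by
  induction n with
  | zero => simpa using h.stationary t (x 0)
  | succ n ih => rw [h.markov, ih, Finset.prod_range_succ, mul_assoc]

/-- The time-reversed chain is a Markov chain with transition matrix `M.reversed`. -/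
lemma reversed_markov (h : IsModulation M μ X D) (t : ℤ) (n : ℕ) (i : M.State)
    (x : ℕ → M.State) :
    μ {ω | X (t - 1) ω = i ∧ ∀ k ≤ n, X (t + k) ω = x k} =
      μ {ω | ∀ k ≤ n, X (t + k) ω = x k} * ENNReal.ofReal (M.reversed (x 0) i) := by
  have hset : {ω | X (t - 1) ω = i ∧ ∀ k ≤ n, X (t + k) ω = x k} =
      {ω | ∀ k ≤ n + 1, X (t - 1 + k) ω = (fun l => Nat.casesOn l i x : ℕ → M.State) k} := by
    ext ω
    constructor
    · rintro ⟨h0, h1⟩ k hk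
      cases k with
      | zero => simpa using h0
      | succ k =>
        have : t - 1 + ((k + 1 : ℕ) : ℤ) = t + k := by push_cast; ring
        rw [this]
        exact h1 k (by omega)
    · intro h1
      refine ⟨by simpa using h1 0 (by omega), fun k hk => ?_⟩
      have h2 := h1 (k + 1) (by omega)
      have : t - 1 + ((k + 1 : ℕ) : ℤ) = t + k := by push_cast; ring
      rwa [this] at h2
  rw [hset, h.path_prob, h.path_prob, Finset.prod_range_succ']
  have hpos := M.stat_pos (x 0)
  -- The definition of the reversed chain: `π_i P_{i,j} = π_j Pʳ_{j,i}` with `j = x 0`.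
  have : ENNReal.ofReal (M.stat i) * ENNReal.ofReal (M.P i (x 0)) =
      ENNReal.ofReal (M.stat (x 0)) * ENNReal.ofReal (M.reversed (x 0) i) := by
    rw [← ENNReal.ofReal_mul (M.stat_pos i).le, ← ENNReal.ofReal_mul hpos.le]
    congr 1
    simp only [Model.reversed, Matrix.of_apply]
    field_simp
  rw [mul_right_comm, ← this, mul_right_comm, mul_assoc]
  rfl

lemma measurable_path (h : IsModulation M μ X D) (s : Finset ℤ) :
    Measurable fun ω (t : s) => X t ω :=
  measurable_pi_lambda _ fun t => h.measurable_chain t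

lemma measurable_data_process (h : IsModulation M μ X D) :
    Measurable fun ω (x : M.State) (t : ℤ) => D x t ω :=
  measurable_pi_lambda _ fun x => measurable_pi_lambda _ fun t => h.measurable_data x t

/-- The window of states includes `v`, although the data stop at `v - 1`. It is thus nonempty even
for `r = v`, where the martingale starts. -/
lemma reversed_markov_Icc (h : IsModulation M μ X D) {r v : ℤ} (hrv : r ≤ v) (i : M.State)
    (x : Finset.Icc r v → M.State) :
    μ {ω | (X (r - 1) ω, fun t : Finset.Icc r v => X t ω) = (i, x)} =
      μ {ω | (fun t : Finset.Icc r v => X t ω) = x} *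
        ENNReal.ofReal (M.reversed (x ⟨r, Finset.left_mem_Icc.2 hrv⟩) i) := by
  classical
  obtain ⟨n, rfl⟩ := Int.le.dest hrv
  set z : ℕ → M.State := fun k => if hk : r + k ∈ Finset.Icc r (r + n) then x ⟨_, hk⟩ else i
  have hz : ∀ ω, (fun t : Finset.Icc r (r + n) => X t ω) = x ↔ ∀ k ≤ n, X (r + k) ω = z k := by
    intro ω
    rw [funext_iff]
    constructor
    · intro h1 k hk
      have hk' : r + (k : ℤ) ∈ Finset.Icc r (r + n) := by simp [hk]
      simpa only [z, dif_pos hk'] using h1 ⟨_, hk'⟩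
    · rintro h1 ⟨t, ht⟩
      obtain ⟨h2, h3⟩ := Finset.mem_Icc.1 ht
      obtain ⟨k, rfl⟩ := Int.le.dest h2
      simpa only [z, dif_pos ht] using h1 k (by omega)
  have hz0 : z 0 = x ⟨r, Finset.left_mem_Icc.2 hrv⟩ := by simp [z]
  simp only [Prod.mk.injEq, hz, ← hz0]
  exact h.reversed_markov r n i z

/-- Along a fixed path of states, the data are members of the independent family `D` with distinct
time indices, whether or not states repeat. -/
lemma indepFun_data_window (h : IsModulation M μ X D) {r v : ℤ} (i : M.State)
    (x : Finset.Icc r v → M.State) :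
    IndepFun (D i (r - 1)) (fun ω (t : Finset.Ico r v) =>
      D (x ⟨t, Finset.Ico_subset_Icc_self t.2⟩) t ω) μ := by
  classical
  set p : Finset.Ico r v → M.State × ℤ := fun t => (x ⟨t, Finset.Ico_subset_Icc_self t.2⟩, t)
  have hd : Disjoint ({(i, r - 1)} : Finset (M.State × ℤ)) (Finset.univ.image p) := by
    rw [Finset.disjoint_singleton_left]
    intro hm
    obtain ⟨t, -, ht⟩ := Finset.mem_image.1 hm
    have h1 := (Finset.mem_Ico.1 t.2).1
    have h2 : (t : ℤ) = r - 1 := congrArg Prod.snd ht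
    omega
  have := h.indep_data.indepFun_finset _ _ hd fun q => h.measurable_data q.1 q.2
  have h1 : Measurable fun f : ({(i, r - 1)} : Finset (M.State × ℤ)) → ℕ =>
      f ⟨(i, r - 1), Finset.mem_singleton_self _⟩ := measurable_pi_apply _
  have h2 : Measurable fun (f : Finset.univ.image p → ℕ) (t : Finset.Ico r v) =>
      f ⟨p t, Finset.mem_image_of_mem p (Finset.mem_univ t)⟩ :=
    measurable_pi_lambda _ fun t => measurable_pi_apply _
  exact this.comp h1 h2

/-- One step back in time, the perturbed chain is driven by the exponential transition matrix. -/
lemma lintegral_step (h : IsModulation M μ X D) {c : ℝ} (hc : M.MGFFinite c)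
    {y : ℤ → Ω → ℕ} (hy : ∀ t ω, y t ω = D (X t ω) t ω)
    {x : M.State → ℝ} (hx : ∀ i, 0 < x i)
    (hxe : ∀ i, ∑ j, M.expTransition c i j * x j = M.perronRoot c * x i)
    {r v : ℤ} (hrv : r ≤ v) (Z : (Finset.Ico r v → ℕ) → ENNReal) :
    ∫⁻ ω, ENNReal.ofReal (x (X (r - 1) ω)) * ENNReal.ofReal (Real.exp (c * y (r - 1) ω)) *
        Z (fun t => y t ω) ∂μ =
      ENNReal.ofReal (M.perronRoot c) *
        ∫⁻ ω, ENNReal.ofReal (x (X r ω)) * Z (fun t => y t ω) ∂μ := by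
  -- `W z d` reads the data `d` along the state path `z`. Summing over all paths separates the chain
  -- from the data.
  set W : (Finset.Icc r v → M.State) → (M.State → ℤ → ℕ) → Finset.Ico r v → ℕ :=
    fun z d t => d (z ⟨t, Finset.Ico_subset_Icc_self t.2⟩) t
  have hW : ∀ z, Measurable (W z) := fun z => by fun_prop
  have hZ : Measurable Z := .of_discrete
  set z₀ : Finset.Icc r v := ⟨r, Finset.left_mem_Icc.2 hrv⟩
  have hpm := h.measurable_path (Finset.Icc r v)
  have hDm := h.measurable_data_process
  have hL : ∫⁻ ω, ENNReal.ofReal (x (X (r - 1) ω)) *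
        ENNReal.ofReal (Real.exp (c * y (r - 1) ω)) * Z (fun t => y t ω) ∂μ =
      ∑ q : M.State × (Finset.Icc r v → M.State),
        μ {ω | (X (r - 1) ω, fun t : Finset.Icc r v => X t ω) = q} *
        ∫⁻ ω, ENNReal.ofReal (x q.1) * ENNReal.ofReal (Real.exp (c * D q.1 (r - 1) ω)) *
          Z (W q.2 fun a t => D a t ω) ∂μ := by
    rw [← IndepFun.lintegral_eq_sum (D := fun ω a t => D a t ω)
      (F := fun q d => ENNReal.ofReal (x q.1) * ENNReal.ofReal (Real.exp (c * d q.1 (r - 1))) *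
          Z (W q.2 d)) ((h.measurable_chain _).prodMk hpm) hDm]
    · simp only [hy, W]
    · exact h.indep_chain.comp (φ := fun f => (f (r - 1), fun t : Finset.Icc r v => f t))
        (by fun_prop) measurable_id
    · intro q
      have := hZ.comp (hW q.2)
      fun_prop
  have hR : ∫⁻ ω, ENNReal.ofReal (x (X r ω)) * Z (fun t => y t ω) ∂μ =
      ∑ z : Finset.Icc r v → M.State, μ {ω | (fun t : Finset.Icc r v => X t ω) = z} *
        ∫⁻ ω, ENNReal.ofReal (x (z z₀)) * Z (W z fun a t => D a t ω) ∂μ := by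
    rw [← IndepFun.lintegral_eq_sum (D := fun ω a t => D a t ω)
      (F := fun z d => ENNReal.ofReal (x (z z₀)) * Z (W z d)) hpm hDm]
    · simp only [hy, W, z₀]
    · exact h.indep_chain.comp (φ := fun f (t : Finset.Icc r v) => f t) (by fun_prop) measurable_id
    · intro z
      exact measurable_const.mul (hZ.comp (hW z))
  have hWD : ∀ z, Measurable fun ω => Z (W z fun a t => D a t ω) := fun z =>
    hZ.comp ((hW z).comp hDm)
  have hI : ∀ i z, ∫⁻ ω, ENNReal.ofReal (x i) * ENNReal.ofReal (Real.exp (c * D i (r - 1) ω)) *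
      Z (W z fun a t => D a t ω) ∂μ = ENNReal.ofReal (x i) * ENNReal.ofReal (M.stateMGF i c) *
        ∫⁻ ω, Z (W z fun a t => D a t ω) ∂μ := by
    intro i z
    have hm : Measurable fun n : ℕ => ENNReal.ofReal (Real.exp (c * n)) := .of_discrete
    have hmD := hm.comp (h.measurable_data i (r - 1))
    simp_rw [mul_assoc]
    rw [lintegral_const_mul' _ _ ENNReal.ofReal_ne_top]
    congr 1
    refine (lintegral_mul_eq_lintegral_mul_lintegral_of_indepFun'' hmD.aemeasurable
      (hWD z).aemeasurable ((h.indepFun_data_window i z).comp hm hZ)).trans ?_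
    congr 1
    rw [← M.lintegral_exp_law hc, ← h.data_law i (r - 1),
      lintegral_map hm (h.measurable_data i (r - 1))]
    rfl
  rw [hL, hR, Fintype.sum_prod_type_right, Finset.mul_sum]
  refine Finset.sum_congr rfl fun z _ => ?_
  rw [lintegral_const_mul _ (hWD z)]
  simp only [h.reversed_markov_Icc hrv, hI]
  have hrev : ∀ i j, 0 ≤ M.reversed i j := fun i j =>
    mul_nonneg (div_nonneg (M.stat_pos j).le (M.stat_pos i).le) (M.ergodic.nonneg j i)
  -- The eigenvector equation in row `z z₀`: the sum over the preceding state `i` reproduces `x (z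
  -- z₀)` times the Perron root.
  have hsum : ENNReal.ofReal (M.perronRoot c) * ENNReal.ofReal (x (z z₀)) =
      ∑ i, ENNReal.ofReal (M.reversed (z z₀) i) *
        (ENNReal.ofReal (x i) * ENNReal.ofReal (M.stateMGF i c)) := by
    rw [← ENNReal.ofReal_mul' (hx _).le, ← hxe, ENNReal.ofReal_sum_of_nonneg]
    · refine Finset.sum_congr rfl fun i _ => ?_
      rw [← ENNReal.ofReal_mul (hx i).le, ← ENNReal.ofReal_mul (hrev _ _)]
      congr 1
      simp only [Model.expTransition, Matrix.of_apply]
      ring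
    · exact fun i _ => mul_nonneg (mul_nonneg (hrev _ _) (M.stateMGF_pos hc i).le) (hx i).le
  calc _ = μ {ω | (fun t : Finset.Icc r v => X t ω) = z} *
        (∑ i, ENNReal.ofReal (M.reversed (z z₀) i) *
          (ENNReal.ofReal (x i) * ENNReal.ofReal (M.stateMGF i c))) *
        ∫⁻ ω, Z (W z fun a t => D a t ω) ∂μ := by
        rw [Finset.mul_sum, Finset.sum_mul]
        exact Finset.sum_congr rfl fun i _ => by ring
    _ = _ := by rw [← hsum]; ring

end IsModulation

/-! ### The martingale of an MMP in reversed time -/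

/-- For every end point `v` there is a nonnegative martingale in the time-reversed direction, of
mean one and adapted to a filtration that contains the data, which up to the constant factor `C`
dominates `exp (c * A(v - n, v) - n * l)`. The martingale property is only stated for events
described by the data. -/
def HasExpMartingale (μ : Measure Ω) (y : ℤ → Ω → ℕ) (c l C : ℝ) : Prop :=
  ∀ v : ℤ, ∃ N : ℕ → Ω → ENNReal, (∀ n, Measurable (N n)) ∧ ∫⁻ ω, N 0 ω ∂μ = 1 ∧
    (∀ (n : ℕ) ω, ENNReal.ofReal (Real.exp (c * cumul y (v - n) v ω - n * l)) ≤
      ENNReal.ofReal C * N n ω) ∧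
    ∀ (n : ℕ) (Z : (Finset.Ico (v - n) v → ℕ) → ENNReal),
      ∫⁻ ω, N (n + 1) ω * Z (fun t => y t ω) ∂μ = ∫⁻ ω, N n ω * Z (fun t => y t ω) ∂μ

lemma IsStationaryMMP.measurable {M : Model.{u}} {y : ℤ → Ω → ℕ} (h : IsStationaryMMP M μ y)
    (t : ℤ) : Measurable (y t) := by
  obtain ⟨X, D, hXD, hy⟩ := h
  rw [funext (hy t)]
  exact (measurable_from_prod_countable_right (f := fun p : M.State × Ω => D p.1 t p.2)
    fun x => hXD.measurable_data x t).comp ((hXD.measurable_chain t).prodMk measurable_id)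

theorem Model.exists_hasExpMartingale (M : Model.{u}) {c : ℝ} (hc : M.MGFFinite c) :
    ∃ C : ℝ, 0 < C ∧ ∀ {Ω : Type w} [MeasurableSpace Ω] (μ : Measure Ω) [IsProbabilityMeasure μ]
      (y : ℤ → Ω → ℕ), IsStationaryMMP M μ y → HasExpMartingale μ y c (Real.log (M.perronRoot c)) C := by
  obtain ⟨hpos, x, hx, hxe⟩ := M.exists_perron_eigenvector hc
  obtain ⟨i₀, hi₀⟩ := Finite.exists_min x
  set H := ∑ i, M.stat i * x i with hH
  have hH0 : 0 < H :=
    Finset.sum_pos (fun i _ => mul_pos (M.stat_pos i) (hx i)) Finset.univ_nonempty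
  -- `H` is the stationary mean of `x`, so dividing by it gives mean one. Since `x ≥ x i₀`, the
  -- prefactor satisfies `(H / x i₀) · x / H ≥ 1`.
  refine ⟨H / x i₀, div_pos hH0 (hx i₀), fun {Ω} _ μ _ y hmmp v => ?_⟩
  have hym := hmmp.measurable
  obtain ⟨X, D, h, hy⟩ := hmmp
  set L := Real.log (M.perronRoot c)
  have hcumul : ∀ n : ℕ, Measurable fun ω => cumul y (v - n) v ω := fun n =>
    Finset.measurable_fun_sum _ fun t _ => hym t
  have hXm : ∀ t, Measurable fun ω => x (X t ω) := fun t =>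
    Measurable.comp (g := x) .of_discrete (h.measurable_chain t)
  refine ⟨fun n ω => ENNReal.ofReal (x (X (v - n) ω)) * (ENNReal.ofReal H⁻¹ *
    ENNReal.ofReal (Real.exp (c * cumul y (v - n) v ω - n * L))), fun n => ?_, ?_, ?_, ?_⟩
  · have h1 : Measurable fun ω => (cumul y (v - n) v ω : ℝ) :=
      Measurable.comp (g := fun k : ℕ => (k : ℝ)) .of_discrete (hcumul n)
    have h2 := hXm (v - n)
    exact h2.ennreal_ofReal.mul (by fun_prop)
  · have hv : Measurable fun f : ℤ → M.State => f v := measurable_pi_apply v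
    have h1 := IndepFun.lintegral_eq_sum (D := fun ω a t => D a t ω)
      (F := fun i _ => ENNReal.ofReal (x i)) (h.measurable_chain v) h.measurable_data_process
      (h.indep_chain.comp hv measurable_id) fun _ => measurable_const
    simp only [lintegral_const, measure_univ, mul_one, h.stationary] at h1
    simp only [Nat.cast_zero, sub_zero, cumul, Finset.Ico_self, Finset.sum_empty, mul_zero,
      zero_mul, Real.exp_zero, ENNReal.ofReal_one, mul_one]
    rw [lintegral_mul_const _ (hXm v).ennreal_ofReal, h1]
    simp_rw [← ENNReal.ofReal_mul (M.stat_pos _).le]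
    rw [← ENNReal.ofReal_sum_of_nonneg fun i _ => (mul_pos (M.stat_pos i) (hx i)).le, ← hH,
      ← ENNReal.ofReal_mul hH0.le, mul_inv_cancel₀ hH0.ne', ENNReal.ofReal_one]
  · intro n ω
    simp only [← mul_assoc]
    refine le_mul_of_one_le_left' ?_
    rw [← ENNReal.ofReal_mul (div_pos hH0 (hx i₀)).le,
      ← ENNReal.ofReal_mul (mul_pos (div_pos hH0 (hx i₀)) (hx _)).le, ENNReal.one_le_ofReal]
    have h1 := (one_le_div (hx i₀)).2 (hi₀ (X (v - n) ω))
    convert! h1 using 1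
    field_simp
  · intro n Z
    have hrv : v - n ≤ v := by omega
    have key := h.lintegral_step hc hy hx hxe hrv fun f => ENNReal.ofReal H⁻¹ *
      ENNReal.ofReal (Real.exp (c * ((∑ t : Finset.Ico (v - n) v, f t : ℕ) : ℝ) - n * L)) * Z f
    have hs : ∀ ω, ∑ t : Finset.Ico (v - n) v, y t ω = cumul y (v - n) v ω := fun ω =>
      Finset.sum_coe_sort _ fun t => y t ω
    have hr : v - ((n + 1 : ℕ) : ℤ) = v - n - 1 := by push_cast; ring
    have hstep : ∀ ω, cumul y (v - n - 1) v ω = y (v - n - 1) ω + cumul y (v - n) v ω := by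
      intro ω
      simp only [cumul]
      rw [← Finset.insert_Ico_add_one_left_eq_Ico (by omega : v - (n : ℤ) - 1 < v),
        Finset.sum_insert (by simp), sub_add_cancel]
    simp only [hs] at key
    have hL : ENNReal.ofReal (Real.exp (-L)) * ENNReal.ofReal (M.perronRoot c) = 1 := by
      rw [← ENNReal.ofReal_mul (Real.exp_nonneg _), Real.exp_neg, Real.exp_log hpos,
        inv_mul_cancel₀ hpos.ne', ENNReal.ofReal_one]
    have hexp : ∀ ω, ENNReal.ofReal (Real.exp (c * cumul y (v - n - 1) v ω -
        ((n + 1 : ℕ) : ℝ) * L)) = ENNReal.ofReal (Real.exp (-L)) *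
          (ENNReal.ofReal (Real.exp (c * y (v - n - 1) ω)) *
          ENNReal.ofReal (Real.exp (c * cumul y (v - n) v ω - n * L))) := by
      intro ω
      rw [hstep, ← ENNReal.ofReal_mul (Real.exp_nonneg _), ← ENNReal.ofReal_mul (Real.exp_nonneg _),
        ← Real.exp_add, ← Real.exp_add]
      congr 2
      push_cast
      ring
    simp only [hr, hexp]
    calc _ = ∫⁻ ω, ENNReal.ofReal (Real.exp (-L)) * (ENNReal.ofReal (x (X (v - n - 1) ω)) *
          ENNReal.ofReal (Real.exp (c * y (v - n - 1) ω)) * (ENNReal.ofReal H⁻¹ *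
          ENNReal.ofReal (Real.exp (c * cumul y (v - n) v ω - n * L)) * Z fun t => y t ω)) ∂μ :=
          lintegral_congr fun ω => by ring
      _ = _ := by
          rw [lintegral_const_mul' _ _ ENNReal.ofReal_ne_top, key, ← mul_assoc, hL, one_mul]
          exact lintegral_congr fun ω => by ring

end MMP

/-! ### Product densities and a maximal inequality -/

namespace MeasureTheory

/-- A product of measures with densities has the product of the densities as its density. -/
lemma Measure.pi_withDensity {ι : Type*} [Fintype ι] {Ω : ι → Type*}
    [∀ i, MeasurableSpace (Ω i)] (μ : ∀ i, Measure (Ω i)) [∀ i, IsProbabilityMeasure (μ i)]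
    {f : ∀ i, Ω i → ENNReal} (hf : ∀ i, Measurable (f i))
    [∀ i, SigmaFinite ((μ i).withDensity (f i))] :
    Measure.pi (fun i => (μ i).withDensity (f i)) =
      (Measure.pi μ).withDensity fun ω => ∏ i, f i (ω i) := by
  refine (Measure.pi_eq fun s hs => ?_)
  have hg : ∀ i, Measurable ((s i).indicator (f i)) := fun i => (hf i).indicator (hs i)
  rw [withDensity_apply _ (.univ_pi hs), ← lintegral_indicator (.univ_pi hs)]
  have h1 : ∀ ω : ∀ i, Ω i, (Set.univ.pi s).indicator (fun ω => ∏ i, f i (ω i)) ω =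
      ∏ i, (s i).indicator (f i) (ω i) := by
    intro ω
    by_cases h : ω ∈ Set.univ.pi s
    · rw [Set.indicator_of_mem h]
      exact Finset.prod_congr rfl fun i _ => (Set.indicator_of_mem (h i trivial) _).symm
    · rw [Set.indicator_of_notMem h]
      simp only [Set.mem_pi, Set.mem_univ, true_imp_iff, not_forall] at h
      obtain ⟨i, hi⟩ := h
      exact (Finset.prod_eq_zero (Finset.mem_univ i) (Set.indicator_of_notMem hi _)).symm
  simp_rw [h1]
  rw [lintegral_prod_eq_prod_lintegral_of_indepFun Finset.univ
    (fun i (ω : ∀ i, Ω i) => (s i).indicator (f i) (ω i))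
    (iIndepFun_pi fun i => (hg i).aemeasurable) fun i => (hg i).comp (measurable_pi_apply i)]
  refine Finset.prod_congr rfl fun i _ => ?_
  rw [withDensity_apply _ (hs i), ← lintegral_indicator (hs i),
    ← lintegral_map (hg i) (measurable_pi_apply i), (measurePreserving_eval μ i).map_eq]

/-- A maximal inequality: if the probability measures `Q n` agree on the first-entrance events of
the sequence `E` up to time `n`, and `ν` is dominated by `K • Q n` on `E n`, then the probability
of ever entering `E` is at most `K`. -/
lemma measure_iUnion_le_of_domination {Ω : Type*} [MeasurableSpace Ω] (ν : Measure Ω)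
    (Q : ℕ → Measure Ω) [∀ n, IsProbabilityMeasure (Q n)] {E : ℕ → Set Ω}
    (hE : ∀ n, MeasurableSet (E n)) {K : ENNReal}
    (hdom : ∀ n F, F ⊆ E n → MeasurableSet F → ν F ≤ K * Q n F)
    (hQ : ∀ n N, n ≤ N → Q N (disjointed E n) = Q n (disjointed E n)) :
    ν (⋃ n, E n) ≤ K := by
  have hd : ∀ n, MeasurableSet (disjointed E n) := fun n => .disjointed hE n
  rw [← iUnion_disjointed, measure_iUnion (disjoint_disjointed E) hd]
  calc ∑' n, ν (disjointed E n) ≤ ∑' n, K * Q n (disjointed E n) :=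
        ENNReal.tsum_le_tsum fun n => hdom n _ (disjointed_subset E n) (hd n)
    _ = K * ∑' n, Q n (disjointed E n) := ENNReal.tsum_mul_left
    _ ≤ K * 1 := by
        refine mul_le_mul_right (ENNReal.tsum_le_of_sum_range_le fun N => ?_) K
        -- All first-entrance events up to `N` are moved to the single probability measure `Q N`,
        -- under which they are disjoint.
        rw [Finset.sum_congr rfl fun n hn => (hQ n N (Finset.mem_range.1 hn).le).symm,
          ← measure_biUnion_finset ((disjoint_disjointed E).set_pairwise _) fun n _ => hd n]
        exact prob_le_one
    _ = K := mul_one K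

end MeasureTheory

/-! ### The exponential bound for a fixed level -/

namespace MMP

variable {Ω : Type w} {ι : Type*}

/-- The event `E` is determined by the data of the flows `j` in the slots `r j, …, v j - 1`. -/
def DeterminedBy (b : ι → ℤ → Ω → ℕ) (r v : ι → ℤ) (E : Set (ι → Ω)) : Prop :=
  ∀ ω ω' : ι → Ω, (∀ j, ∀ t ∈ Finset.Ico (r j) (v j), b j t (ω j) = b j t (ω' j)) →
    ω ∈ E → ω' ∈ E

lemma DeterminedBy.mono {b : ι → ℤ → Ω → ℕ} {r r' v : ι → ℤ} {E : Set (ι → Ω)}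
    (h : DeterminedBy b r v E) (hr : ∀ j, r' j ≤ r j) : DeterminedBy b r' v E :=
  fun ω ω' hω => h ω ω' fun j t ht => hω j t (Finset.Ico_subset_Ico_left (hr j) ht)

variable [MeasurableSpace Ω] [Fintype ι] {μ : Measure Ω} [IsProbabilityMeasure μ]

/-- For independent processes with exponential martingales, an exponential bound for the
probability that a weighted sum of the processes ever reaches a level, in the canonical case of a
product space. -/
lemma pi_measure_exists_le {b : ι → ℤ → Ω → ℕ} (hb : ∀ j t, Measurable (b j t))
    {c l C : ι → ℝ} (hC : ∀ j, 0 ≤ C j) (hN : ∀ j, HasExpMartingale μ (b j) (c j) (l j) (C j))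
    (hl : ∑ j, l j ≤ 0) {r v : ι → ℤ} (hrv : ∀ j, r j ≤ v j) (y : ℝ) :
    Measure.pi (fun _ : ι => μ)
        {ω | ∃ τ : ℕ, y ≤ ∑ j, c j * cumul (b j) (r j - τ) (v j) (ω j)} ≤
      ENNReal.ofReal (∏ j, C j) * ENNReal.ofReal (Real.exp (∑ j, l j * (v j - r j) - y)) := by
  choose N hNm hN0 hNC hNs using fun j => hN j (v j)
  choose n hn using fun j => Int.le.dest (hrv j)
  have hN1 : ∀ j k, ∫⁻ ω, N j k ω ∂μ = 1 := by
    intro j k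
    induction k with
    | zero => exact hN0 j
    | succ k ih => simpa [ih] using hNs j k fun _ => 1
  have hP : ∀ j k, IsProbabilityMeasure (μ.withDensity (N j k)) := fun j k =>
    ⟨by rw [withDensity_apply _ .univ, setLIntegral_univ, hN1]⟩
  have hr : ∀ (j) (τ : ℕ), v j - ((n j + τ : ℕ) : ℤ) = r j - τ := fun j τ => by
    rw [← hn j]
    push_cast
    ring
  -- At `τ = 0` the window of flow `j` already has length `n j = v j - r j`; its martingale is
  -- therefore taken at step `n j + τ`.
  set Q : ℕ → Measure (ι → Ω) := fun τ => Measure.pi fun j => μ.withDensity (N j (n j + τ))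
  set E : ℕ → Set (ι → Ω) := fun τ => {ω | y ≤ ∑ j, c j * cumul (b j) (r j - τ) (v j) (ω j)}
  have hEm : ∀ τ, MeasurableSet (E τ) := fun τ => by
    refine measurableSet_le measurable_const (Finset.measurable_fun_sum _ fun j _ => ?_)
    have h1 : Measurable fun ω => cumul (b j) (r j - τ) (v j) ω :=
      Finset.measurable_fun_sum _ fun t _ => hb j t
    exact measurable_const.mul
      (((measurable_of_countable fun k : ℕ => (k : ℝ)).comp h1).comp (measurable_pi_apply j))
  have hstep : ∀ (τ : ℕ) F, DeterminedBy b (fun j => r j - τ) v F → Q (τ + 1) F = Q τ F := by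
    intro τ F hF
    set win : ∀ j, Ω → (Finset.Ico (r j - (τ : ℤ)) (v j) → ℕ) := fun j ω t => b j t ω
    have hwin : ∀ j, Measurable (win j) := fun j => measurable_pi_lambda _ fun t => hb j t
    set W : (ι → Ω) → ∀ j, Finset.Ico (r j - (τ : ℤ)) (v j) → ℕ := fun ω j => win j (ω j)
    have hW : Measurable W :=
      measurable_pi_lambda _ fun j => (hwin j).comp (measurable_pi_apply j)
    -- An event determined by the data is a preimage under `W`, whose target is countable and
    -- discrete. Measurability of `F` is thus automatic, and only the laws of the windows matter.
    have hFW : F = W ⁻¹' (W '' F) := by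
      refine (Set.subset_preimage_image W F).antisymm ?_
      rintro ω ⟨ω', hω', h⟩
      exact hF ω' ω (fun j t ht => congrFun (congrFun h j) ⟨t, ht⟩) hω'
    have hmap : ∀ j, (μ.withDensity (N j (n j + (τ + 1)))).map (win j) =
        (μ.withDensity (N j (n j + τ))).map (win j) := by
      intro j
      ext s hs
      have h1 : ∀ k, (μ.withDensity (N j k)).map (win j) s =
          ∫⁻ ω, N j k ω * s.indicator 1 (win j ω) ∂μ := by
        intro k
        rw [Measure.map_apply (hwin j) hs, withDensity_apply _ (hwin j hs),
          ← lintegral_indicator (hwin j hs)]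
        refine lintegral_congr fun ω => ?_
        by_cases h : win j ω ∈ s <;> simp [Set.indicator, h]
      rw [h1, h1]
      have h2 := hNs j (n j + τ)
      rw [hr] at h2
      exact h2 fun f => s.indicator 1 f
    have hQW : ∀ τ', (Q τ').map W =
        Measure.pi fun j => (μ.withDensity (N j (n j + τ'))).map (win j) := fun τ' => by
      have : ∀ j, IsProbabilityMeasure ((μ.withDensity (N j (n j + τ'))).map (win j)) := fun j =>
        Measure.isProbabilityMeasure_map (hwin j).aemeasurable
      exact Measure.pi_map_pi fun j => (hwin j).aemeasurable
    have hset : MeasurableSet (W '' F) := .of_discrete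
    rw [hFW, ← Measure.map_apply hW hset, ← Measure.map_apply hW hset, hQW, hQW]
    simp_rw [hmap]
  have hdet : ∀ τ : ℕ, DeterminedBy b (fun j => r j - τ) v (E τ) := by
    intro τ ω ω' h hω
    have : ∀ j, cumul (b j) (r j - τ) (v j) (ω' j) = cumul (b j) (r j - τ) (v j) (ω j) :=
      fun j => Finset.sum_congr rfl fun t ht => (h j t ht).symm
    simp only [E, Set.mem_ofPred_eq, this]
    exact hω
  have hdis : ∀ τ : ℕ, DeterminedBy b (fun j => r j - τ) v (disjointed E τ) := by
    intro τ ω ω' h hω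
    rw [disjointed_eq_inter_compl] at hω ⊢
    refine ⟨hdet τ ω ω' h hω.1, Set.mem_iInter₂.2 fun σ hσ hω' => ?_⟩
    exact Set.mem_iInter₂.1 hω.2 σ hσ
      ((hdet σ).mono (fun j => by omega) ω' ω (fun j t ht => (h j t ht).symm) hω')
  have hset : {ω : ι → Ω | ∃ τ : ℕ, y ≤ ∑ j, c j * cumul (b j) (r j - τ) (v j) (ω j)} =
      ⋃ τ, E τ := by
    ext ω
    simp [E]
  rw [hset]
  refine measure_iUnion_le_of_domination _ Q hEm ?_ ?_
  · intro τ F hF hFm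
    simp only [Q]
    rw [Measure.pi_withDensity _ fun j => hNm j _, withDensity_apply _ hFm,
      ← lintegral_const_mul' _ _ (ENNReal.mul_ne_top ENNReal.ofReal_ne_top ENNReal.ofReal_ne_top),
      ← setLIntegral_one]
    refine setLIntegral_mono' hFm fun ω hω => ?_
    -- The lower bound for the density on `E τ`. The exponent contains `-τ ∑ l j`, which is
    -- nonnegative and can be dropped.
    have h1 : ENNReal.ofReal (Real.exp (y - ∑ j, l j * (v j - r j))) ≤
        ENNReal.ofReal (∏ j, C j) * ∏ j, N j (n j + τ) (ω j) := by
      calc _ ≤ ENNReal.ofReal (Real.exp (∑ j, (c j * cumul (b j) (r j - τ) (v j) (ω j) -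
            (n j + τ : ℕ) * l j))) := by
            refine ENNReal.ofReal_le_ofReal (Real.exp_le_exp.2 ?_)
            have h2 : y ≤ ∑ j, c j * cumul (b j) (r j - τ) (v j) (ω j) := hF hω
            have h3 : ∑ j, ((n j + τ : ℕ) : ℝ) * l j =
                ∑ j, l j * (v j - r j) + τ * ∑ j, l j := by
              rw [Finset.mul_sum, ← Finset.sum_add_distrib]
              refine Finset.sum_congr rfl fun j _ => ?_
              have : (v j : ℝ) = r j + n j := by exact_mod_cast (hn j).symm
              rw [this]
              push_cast
              ring
            have h4 : (τ : ℝ) * ∑ j, l j ≤ 0 := mul_nonpos_of_nonneg_of_nonpos τ.cast_nonneg hl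
            rw [Finset.sum_sub_distrib, h3]
            linarith
        _ = ∏ j, ENNReal.ofReal (Real.exp (c j * cumul (b j) (r j - τ) (v j) (ω j) -
            (n j + τ : ℕ) * l j)) := by
            rw [Real.exp_sum, ENNReal.ofReal_prod_of_nonneg fun j _ => Real.exp_nonneg _]
        _ ≤ ∏ j, (ENNReal.ofReal (C j) * N j (n j + τ) (ω j)) := by
            refine Finset.prod_le_prod' fun j _ => ?_
            have := hNC j (n j + τ) (ω j)
            rwa [hr] at this
        _ = _ := by rw [Finset.prod_mul_distrib, ENNReal.ofReal_prod_of_nonneg fun j _ => hC j]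
    calc (1 : ENNReal) = ENNReal.ofReal (Real.exp (∑ j, l j * (v j - r j) - y)) *
          ENNReal.ofReal (Real.exp (y - ∑ j, l j * (v j - r j))) := by
          rw [← ENNReal.ofReal_mul (Real.exp_nonneg _), ← Real.exp_add]
          simp
      _ ≤ _ := mul_le_mul_right h1 _
      _ = _ := by ring
  · intro τ T hT
    induction T, hT using Nat.le_induction with
    | base => rfl
    | succ T hT ih =>
      rw [hstep T _ ((hdis τ).mono fun j => by omega), ih]

end MMP

/-! ### Random levels and the main theorem -/

namespace MMP

/-- For independent processes with exponential martingales, an exponential bound for the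
probability that a weighted sum of the processes ever reaches an independent random level. -/
theorem measure_exists_level_le {Ω : Type w} [MeasurableSpace Ω] {ι : Type*} [Fintype ι]
    {μ : Measure Ω} [IsProbabilityMeasure μ] {b : ι → ℤ → Ω → ℕ}
    (hb : ∀ j t, Measurable (b j t)) (hind : iIndepFun (fun j ω (t : ℤ) => b j t ω) μ)
    {c l C : ι → ℝ} (hC : ∀ j, 0 ≤ C j) (hN : ∀ j, HasExpMartingale μ (b j) (c j) (l j) (C j))
    (hl : ∑ j, l j ≤ 0) {r v : ι → ℤ} (hrv : ∀ j, r j ≤ v j) {Y : Ω → ℝ} (hY : Measurable Y)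
    (hYb : IndepFun Y (fun ω (j : ι) (t : ℤ) => b j t ω) μ) :
    μ {ω | ∃ τ : ℕ, Y ω ≤ ∑ j, c j * cumul (b j) (r j - τ) (v j) ω} ≤
      ∫⁻ ω, ENNReal.ofReal (∏ j, C j) *
        ENNReal.ofReal (Real.exp (∑ j, l j * (v j - r j) - Y ω)) ∂μ := by
  have hbm : ∀ j, Measurable fun ω (t : ℤ) => b j t ω := fun j =>
    measurable_pi_lambda _ fun t => hb j t
  have hBm : Measurable fun ω (j : ι) (t : ℤ) => b j t ω := measurable_pi_lambda _ hbm
  set T : Set (ℝ × (ι → ℤ → ℕ)) := {p | ∃ τ : ℕ,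
    p.1 ≤ ∑ j, c j * cumul (fun t (d : ℤ → ℕ) => d t) (r j - τ) (v j) (p.2 j)} with hTdef
  have hT : MeasurableSet T := by
    rw [hTdef, Set.ofPred_exists]
    refine .iUnion fun τ => measurableSet_le measurable_fst
      (Finset.measurable_fun_sum _ fun j _ => measurable_const.mul ?_)
    have h1 : Measurable fun p : ℝ × (ι → ℤ → ℕ) =>
        cumul (fun t (d : ℤ → ℕ) => d t) (r j - τ) (v j) (p.2 j) :=
      Finset.measurable_fun_sum _ fun t _ => by fun_prop
    exact (measurable_of_countable fun k : ℕ => (k : ℝ)).comp h1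
  -- Independence of the flows: their joint law is that of copies living on separate factors of a
  -- product space.
  have hmap : μ.map (fun ω (j : ι) (t : ℤ) => b j t ω) =
      (Measure.pi fun _ : ι => μ).map fun ω j t => b j t (ω j) := by
    have : ∀ j, IsProbabilityMeasure (μ.map fun ω (t : ℤ) => b j t ω) := fun j =>
      Measure.isProbabilityMeasure_map (hbm j).aemeasurable
    rw [(iIndepFun_iff_map_fun_eq_pi_map fun j => (hbm j).aemeasurable).1 hind]
    exact (Measure.pi_map_pi fun j => (hbm j).aemeasurable).symm
  have hpim : Measurable fun (ω : ι → Ω) j (t : ℤ) => b j t (ω j) :=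
    measurable_pi_lambda _ fun j => (hbm j).comp (measurable_pi_apply j)
  calc μ {ω | ∃ τ : ℕ, Y ω ≤ ∑ j, c j * cumul (b j) (r j - τ) (v j) ω}
      = μ.map (fun ω => (Y ω, fun (j : ι) (t : ℤ) => b j t ω)) T :=
        (Measure.map_apply (hY.prodMk hBm) hT).symm
    _ = ∫⁻ ω, μ.map (fun ω (j : ι) (t : ℤ) => b j t ω) (Prod.mk (Y ω) ⁻¹' T) ∂μ := by
        have : IsProbabilityMeasure (μ.map fun ω (j : ι) (t : ℤ) => b j t ω) :=
          Measure.isProbabilityMeasure_map hBm.aemeasurable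
        rw [(indepFun_iff_map_prod_eq_prod_map_map hY.aemeasurable hBm.aemeasurable).1 hYb,
          Measure.prod_apply hT, lintegral_map (measurable_measure_prodMk_left hT) hY]
    _ ≤ _ := by
        refine lintegral_mono fun ω => ?_
        rw [hmap, Measure.map_apply hpim (measurable_prodMk_left hT)]
        exact pi_measure_exists_le hb hC hN hl hrv (Y ω)

/-- The net input is integer-valued: if all its values are below `y`, they are at most `⌈y⌉ - 1 <
y`, and so is their supremum. -/
lemma le_iSup_netInput_iff {Ω : Type w} {m : ℕ} (a : Fin m → ℤ → Ω → ℕ) (s : ℤ → Ω → ℕ)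
    (u v : Fin (m + 1) → ℕ) (y : ℝ) (ω : Ω) :
    (y : EReal) ≤ ⨆ τ : ℕ, ((netInput a s u v τ ω : ℝ) : EReal) ↔
      ∃ τ : ℕ, y ≤ netInput a s u v τ ω := by
  constructor
  · intro h
    by_contra! hlt
    have h1 : ∀ τ, ((netInput a s u v τ ω : ℝ) : EReal) ≤ ((⌈y⌉ - 1 : ℤ) : ℝ) := fun τ => by
      have : netInput a s u v τ ω < ⌈y⌉ := Int.lt_ceil.2 (hlt τ)
      exact_mod_cast Int.le_sub_one_of_lt this
    have h2 : y ≤ ((⌈y⌉ - 1 : ℤ) : ℝ) := by exact_mod_cast h.trans (iSup_le h1)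
    have h3 := Int.ceil_le.2 h2
    omega
  · rintro ⟨τ, hτ⟩
    exact le_iSup_of_le τ (by exact_mod_cast hτ)

end MMP

theorem mainTheorem2 {m : ℕ} (MA : Fin m → MMP.Model.{u}) (MS : MMP.Model.{v})
    (θ : ℝ) (hθ : 0 ≤ θ) (hfin : ∀ i, (MA i).MGFFinite θ)
    (hstable : ∑ i, (MA i).arrivalRate θ - MS.serviceRate θ ≤ 0) :
    ∃ ξ : ℝ, 0 < ξ ∧
      ∀ {Ω : Type w} [MeasurableSpace Ω] (μ : Measure Ω) [IsProbabilityMeasure μ]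
        (a : Fin m → ℤ → Ω → ℕ) (s : ℤ → Ω → ℕ) (Y : Ω → ℝ),
        (∀ i, MMP.IsStationaryMMP (MA i) μ (a i)) →
        MMP.IsStationaryMMP MS μ s →
        iIndepFun (fun (j : Fin (m + 1)) ω (t : ℤ) =>
          (Fin.cons s a : Fin (m + 1) → ℤ → Ω → ℕ) j t ω) μ →
        Measurable Y →
        IndepFun Y (fun ω => ((fun (i : Fin m) (t : ℤ) => a i t ω), fun t : ℤ => s t ω)) μ →
        ∀ u v : Fin (m + 1) → ℕ, (∀ j, u j ≤ v j) →
          μ {ω | (Y ω : EReal) ≤ ⨆ τ : ℕ, ((MMP.netInput a s u v τ ω : ℝ) : EReal)} ≤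
            ENNReal.ofReal ξ * (∫⁻ ω, ENNReal.ofReal (Real.exp (-θ * Y ω)) ∂μ) *
              ENNReal.ofReal (Real.exp (θ *
                (∑ i : Fin m, (MA i).arrivalRate θ * ((v i.succ : ℝ) - u i.succ)
                  - MS.serviceRate θ * ((v 0 : ℝ) - u 0)))) := by
  -- For `θ = 0` the bound is the trivial one by `1`.
  rcases hθ.eq_or_lt with rfl | hθ0
  · refine ⟨1, one_pos, fun μ _ a s Y _ _ _ _ _ u v _ => ?_⟩
    simpa using prob_le_one
  choose CA hCA hA using fun i => (MA i).exists_hasExpMartingale.{u, w} (hfin i)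
  -- The service enters with exponent `-θ ≤ 0`, where the moment-generating functions of nonnegative
  -- data are always finite.
  obtain ⟨CS, hCS, hS⟩ := MS.exists_hasExpMartingale.{v, w}
    (MS.MGFFinite_of_nonpos (neg_nonpos.2 hθ))
  refine ⟨CS * ∏ i, CA i, mul_pos hCS (Finset.prod_pos fun i _ => hCA i),
    fun {Ω} _ μ _ a s Y ha hs hind hY hYind u v huv => ?_⟩
  have hrateA : ∀ i, Real.log ((MA i).perronRoot θ) = θ * (MA i).arrivalRate θ := fun i => by
    rw [MMP.Model.arrivalRate]
    field_simp
  have hrateS : Real.log (MS.perronRoot (-θ)) = -(θ * MS.serviceRate θ) := by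
    rw [MMP.Model.serviceRate]
    field_simp
  set c : Fin (m + 1) → ℝ := Fin.cons (-θ) fun _ => θ
  set l : Fin (m + 1) → ℝ :=
    Fin.cons (Real.log (MS.perronRoot (-θ))) fun i => Real.log ((MA i).perronRoot θ)
  set C : Fin (m + 1) → ℝ := Fin.cons CS CA
  have hB : Measurable fun p : (Fin m → ℤ → ℕ) × (ℤ → ℕ) =>
      (Fin.cons p.2 p.1 : Fin (m + 1) → ℤ → ℕ) :=
    measurable_pi_lambda _ <| Fin.cases measurable_snd fun i =>
      (measurable_pi_apply i).comp measurable_fst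
  have hYb : IndepFun (fun ω => θ * Y ω) (fun ω (j : Fin (m + 1)) (t : ℤ) =>
      (Fin.cons s a : Fin (m + 1) → ℤ → Ω → ℕ) j t ω) μ := by
    convert! hYind.comp (measurable_const_mul θ) hB using 1
    funext ω j
    refine Fin.cases ?_ (fun i => ?_) j <;> rfl
  have key := MMP.measure_exists_level_le (b := (Fin.cons s a : Fin (m + 1) → ℤ → Ω → ℕ))
    (c := c) (l := l) (C := C) (r := fun j => (u j : ℤ)) (v := fun j => (v j : ℤ))
    (Fin.cases hs.measurable fun i => (ha i).measurable) hind
    (Fin.cases hCS.le fun i => (hCA i).le) (Fin.cases (hS μ s hs) fun i => hA i μ (a i) (ha i))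
    (by
      -- The sum of the `l j` is `θ` times the left-hand side of the stability condition.
      simp only [l, Fin.sum_univ_succ, Fin.cons_zero, Fin.cons_succ, hrateA, hrateS,
        ← Finset.mul_sum]
      nlinarith)
    (fun j => by exact_mod_cast huv j) (hY.const_mul θ) hYb
  have hset : {ω | (Y ω : EReal) ≤ ⨆ τ : ℕ, ((MMP.netInput a s u v τ ω : ℝ) : EReal)} =
      {ω | ∃ τ : ℕ, θ * Y ω ≤ ∑ j, c j * MMP.cumul
        ((Fin.cons s a : Fin (m + 1) → ℤ → Ω → ℕ) j) ((u j : ℤ) - τ) (v j) ω} := by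
    ext ω
    simp only [Set.mem_ofPred_eq, MMP.le_iSup_netInput_iff]
    refine exists_congr fun τ => ?_
    rw [← mul_le_mul_iff_right₀ hθ0]
    refine iff_of_eq (congrArg _ ?_)
    simp only [MMP.netInput, c, Fin.sum_univ_succ, Fin.cons_zero, Fin.cons_succ, ← Finset.mul_sum]
    push_cast
    ring
  rw [hset]
  refine key.trans (le_of_eq ?_)
  have hCprod : ∏ j, C j = CS * ∏ i, CA i := by simp [C, Fin.prod_univ_succ]
  have hlsum : ∑ j, l j * (((v j : ℤ) : ℝ) - ((u j : ℤ) : ℝ)) =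
      θ * (∑ i : Fin m, (MA i).arrivalRate θ * ((v i.succ : ℝ) - u i.succ)
        - MS.serviceRate θ * ((v 0 : ℝ) - u 0)) := by
    simp only [l, Fin.sum_univ_succ, Fin.cons_zero, Fin.cons_succ, hrateA, hrateS, mul_sub,
      Finset.mul_sum, Int.cast_natCast]
    rw [add_comm]
    simp only [mul_assoc, ← mul_sub]
    ring
  rw [hCprod, hlsum, lintegral_const_mul' _ _ ENNReal.ofReal_ne_top, mul_assoc]
  congr 1
  rw [← lintegral_mul_const' _ _ ENNReal.ofReal_ne_top]
  refine lintegral_congr fun ω => ?_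
  rw [← ENNReal.ofReal_mul (Real.exp_nonneg _), ← Real.exp_add]
  congr 2
  ring
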